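/- A ($2$-)copula is a function $C:[0,1]^2\to[0,1]$ with $C(u,0)=C(0,v)=0$, $C(u,1)=u$, $C(1,v)=v$ for all $u,v\in[0,1]$, and $C(u_2,v_2)-C(u_1,v_2)-C(u_2,v_1)+C(u_1,v_1)\ge 0$ whenever $0\le u_1\le u_2\le 1$ and $0\le v_1\le v_2\le 1$. The Markov product of two copulas is $(C_1*C_2)(u,v)=\int_0^1\partial_2C_1(u,t)\,\partial_1C_2(t,v)\,dt$ (the partial derivatives exist for almost every $t$), and the Markov powers of $C$ are $C^{*1}=C$, $C^{*(n+1)}=C*C^{*n}$ for $n\ge1$. A copula $C$ is stochastically increasing in the first component if, for every $v\in[0,1]$, the function $u\mapsto\partial_1C(u,v)$ is decreasing (in the weak sense) on $[0,1]$ outside a Lebesgue null set. Proposition. Let $C$ be a copula that is stochastically increasing in the first component. Then $C^{*(n+1)}(u,v)\le C^{*n}(u,v)$ for all $n\ge1$ and all $u,v\in[0,1]$. Moreover, there exist a countable (possibly empty) family $(a_k,b_k)_{k\in\mathcal I}$ of pairwise disjoint nonempty open intervals contained in $(0,1)$ and a copula $S$ that is the ordinal sum of the independence copula $\Pi(u,v)=uv$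 with respect to this family, that is, $$S(u,v)=\begin{cases}a_k+\dfrac{(u-a_k)(v-a_k)}{b_k-a_k}&\text{if }(u,v)\in(a_k,b_k)^2\text{ for some }k\in\mathcal I,\\[1ex]\min(u,v)&\text{otherwise,}\end{cases}$$ such that $C^{*n}(u,v)\to S(u,v)$ as $n\to\infty$ for all $u,v\in[0,1]$. -/

import Mathlib

namespace Copulas

/-- `C` restricted to the unit square is a (two-dimensional) copula: a bivariate distribution
function on `[0,1]²` with uniform margins, i.e. grounded, with uniform margins and 2-increasing.
The values of `C` outside `[0,1]²` are irrelevant. -/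
structure IsCopula (C : ℝ → ℝ → ℝ) : Prop where
  left_zero : ∀ v ∈ Set.Icc (0 : ℝ) 1, C 0 v = 0
  right_zero : ∀ u ∈ Set.Icc (0 : ℝ) 1, C u 0 = 0
  left_one : ∀ v ∈ Set.Icc (0 : ℝ) 1, C 1 v = v
  right_one : ∀ u ∈ Set.Icc (0 : ℝ) 1, C u 1 = u
  two_increasing : ∀ u₁ ∈ Set.Icc (0 : ℝ) 1, ∀ u₂ ∈ Set.Icc (0 : ℝ) 1,
    ∀ v₁ ∈ Set.Icc (0 : ℝ) 1, ∀ v₂ ∈ Set.Icc (0 : ℝ) 1, u₁ ≤ u₂ → v₁ ≤ v₂ →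
      0 ≤ C u₂ v₂ - C u₁ v₂ - C u₂ v₁ + C u₁ v₁

/-- The independence (product) copula `Π`. -/
def independence (u v : ℝ) : ℝ := u * v

/-- The upper Fréchet–Hoeffding bound `C⁺`. -/
noncomputable def upperBound (u v : ℝ) : ℝ := min u v

/-- The partial derivative `∂₁ C (u, v)`. -/
noncomputable def partial₁ (C : ℝ → ℝ → ℝ) (u v : ℝ) : ℝ := deriv (fun s => C s v) u

/-- The partial derivative `∂₂ C (u, v)`. -/
noncomputable def partial₂ (C : ℝ → ℝ → ℝ) (u v : ℝ) : ℝ := deriv (fun t => C u t) v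

/-- The Markov product `(C₁ * C₂)(u, v) = ∫₀¹ ∂₂C₁(u, t) ∂₁C₂(t, v) dt`. For copulas the two partial
derivatives exist for almost every `t ∈ (0,1)` and take values in `[0,1]` there. -/
noncomputable def markovProduct (C₁ C₂ : ℝ → ℝ → ℝ) (u v : ℝ) : ℝ :=
  ∫ t in (0 : ℝ)..1, partial₂ C₁ u t * partial₁ C₂ t v

/-- The Markov powers `C^{*n}`: `C^{*1} = C` and `C^{*(n+1)} = C * C^{*n}` for `n ≥ 1`. By
convention `C^{*0}` is the unit `C⁺` of the Markov product. -/
noncomputable def markovPower (C : ℝ → ℝ → ℝ) : ℕ → ℝ → ℝ → ℝ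
  | 0 => upperBound
  | 1 => C
  | n + 2 => markovProduct C (markovPower C (n + 1))

/-- `C` is stochastically increasing in the first component: for every `v ∈ [0,1]`, the function
`u ↦ ∂₁ C (u, v)` is decreasing on `[0,1]` up to a Lebesgue null set. -/
def StochasticallyIncreasing₁ (C : ℝ → ℝ → ℝ) : Prop :=
  ∀ v ∈ Set.Icc (0 : ℝ) 1, ∃ N : Set ℝ, MeasureTheory.volume N = 0 ∧
    AntitoneOn (fun u => partial₁ C u v) (Set.Icc (0 : ℝ) 1 \ N)

/-- The `(a k, b k)`, `k : I`, form a countable family of disjoint (nonempty, open) subintervals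
of `(0,1)`. The family may be empty. -/
structure IsIntervalFamily {I : Type*} (a b : I → ℝ) : Prop where
  countable : Countable I
  nonneg : ∀ k, 0 ≤ a k
  lt : ∀ k, a k < b k
  le_one : ∀ k, b k ≤ 1
  disjoint : ∀ k l, k ≠ l → Disjoint (Set.Ioo (a k) (b k)) (Set.Ioo (a l) (b l))

/-- The copula `C` is the ordinal sum of `(D k)` with respect to the family `(a k, b k)`. -/
structure IsOrdinalSum {I : Type*} (a b : I → ℝ) (D : I → ℝ → ℝ → ℝ) (C : ℝ → ℝ → ℝ) : Prop where
  isCopula : IsCopula C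
  eq_of_mem : ∀ k, ∀ u ∈ Set.Ioo (a k) (b k), ∀ v ∈ Set.Ioo (a k) (b k),
    C u v = a k + (b k - a k) * D k ((u - a k) / (b k - a k)) ((v - a k) / (b k - a k))
  eq_of_notMem : ∀ u ∈ Set.Icc (0 : ℝ) 1, ∀ v ∈ Set.Icc (0 : ℝ) 1,
    (∀ k, ¬ (u ∈ Set.Ioo (a k) (b k) ∧ v ∈ Set.Ioo (a k) (b k))) → C u v = upperBound u v

end Copulas

/-! Fix `v` and let `g = ∂₁D(·,v)` for a stochastically increasing copula `D`. As `g` is essentially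
decreasing with values in `[0,1]`, its superlevel sets are, up to null sets, intervals `(0, τ y)`,
so the layer-cake formula turns `∫ H' g` into `∫ H(τ y) dy` (`exists_integral_deriv_mul_eq`). With
`H = min u ·` this gives `D u v`, with `H = C u ·` it gives `(C * D) u v`. Since `C ≤ min`, it
follows that `C * D ≤ D`: the powers decrease and have a pointwise limit `S`.

Stochastic monotonicity amounts to concavity in `u`, which survives averages and pointwise limits.
Concavity also forces the derivatives to converge, so `C * S = S` by dominated convergence. Now `C ≤
min` is an equality under the average representing `S`, which puts almost every `τ y` in the set `E`
of `s` with `C s s = s`. Each `min · s` with `s ∈ E` is affine on the gaps of `E`, hence so is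
`S(·,v)`; as `S = min` whenever a coordinate lies in `E`, this determines `S`. -/

namespace Copulas

open MeasureTheory Set Filter Topology

/-! ### Sections of copulas and their derivatives -/

/-- The properties shared by all sections `C(u, ·)` and `C(·, v)` of a copula. -/
structure IsSection (f : ℝ → ℝ) : Prop where
  zero : f 0 = 0
  mono : ∀ x ∈ Icc (0 : ℝ) 1, ∀ y ∈ Icc (0 : ℝ) 1, x ≤ y → f x ≤ f y
  sub_le : ∀ x ∈ Icc (0 : ℝ) 1, ∀ y ∈ Icc (0 : ℝ) 1, x ≤ y → f y - f x ≤ y - x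

lemma zero_mem_Icc : (0 : ℝ) ∈ Icc (0 : ℝ) 1 := by simp

lemma one_mem_Icc : (1 : ℝ) ∈ Icc (0 : ℝ) 1 := by simp

lemma IsCopula.flip {C : ℝ → ℝ → ℝ} (hC : IsCopula C) : IsCopula (fun u v => C v u) where
  left_zero := hC.right_zero
  right_zero := hC.left_zero
  left_one := hC.right_one
  right_one := hC.left_one
  two_increasing u₁ hu₁ u₂ hu₂ v₁ hv₁ v₂ hv₂ hu hv := by
    have := hC.two_increasing v₁ hv₁ v₂ hv₂ u₁ hu₁ u₂ hu₂ hv hu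
    linarith

lemma IsCopula.isSection_left {C : ℝ → ℝ → ℝ} (hC : IsCopula C) {v : ℝ}
    (hv : v ∈ Icc (0 : ℝ) 1) : IsSection (fun u => C u v) where
  zero := hC.left_zero v hv
  mono x hx y hy hxy := by
    have := hC.two_increasing x hx y hy 0 zero_mem_Icc v hv hxy hv.1
    rw [hC.right_zero x hx, hC.right_zero y hy] at this
    linarith
  sub_le x hx y hy hxy := by
    have := hC.two_increasing x hx y hy v hv 1 one_mem_Icc hxy hv.2
    rw [hC.right_one x hx, hC.right_one y hy] at this
    linarith

lemma IsCopula.isSection_right {C : ℝ → ℝ → ℝ} (hC : IsCopula C) {u : ℝ}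
    (hu : u ∈ Icc (0 : ℝ) 1) : IsSection (fun v => C u v) :=
  hC.flip.isSection_left hu

namespace IsSection

variable {f : ℝ → ℝ}

lemma nonneg (hf : IsSection f) {x : ℝ} (hx : x ∈ Icc (0 : ℝ) 1) : 0 ≤ f x := by
  have := hf.mono 0 zero_mem_Icc x hx hx.1
  rwa [hf.zero] at this

lemma le_self (hf : IsSection f) {x : ℝ} (hx : x ∈ Icc (0 : ℝ) 1) : f x ≤ x := by
  have := hf.sub_le 0 zero_mem_Icc x hx hx.1
  rw [hf.zero] at this
  linarith

lemma lipschitzOnWith (hf : IsSection f) : LipschitzOnWith 1 f (Icc 0 1) := by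
  refine LipschitzOnWith.of_le_add_mul 1 fun x hx y hy => ?_
  rcases le_total x y with h | h
  · have := hf.mono x hx y hy h
    have := dist_nonneg (x := x) (y := y)
    simp only [NNReal.coe_one]; linarith
  · have := hf.sub_le y hy x hx h
    have := le_abs_self (x - y)
    simp only [NNReal.coe_one, Real.dist_eq]; linarith

lemma absolutelyContinuous (hf : IsSection f) {x : ℝ} (hx : x ∈ Icc (0 : ℝ) 1) :
    AbsolutelyContinuousOnInterval f 0 x := by
  apply LipschitzOnWith.absolutelyContinuousOnInterval (K := 1)
  rw [uIcc_of_le hx.1]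
  exact hf.lipschitzOnWith.mono (Icc_subset_Icc_right hx.2)

lemma integral_deriv (hf : IsSection f) {x : ℝ} (hx : x ∈ Icc (0 : ℝ) 1) :
    ∫ t in (0 : ℝ)..x, deriv f t = f x := by
  rw [(hf.absolutelyContinuous hx).integral_deriv_eq_sub, hf.zero, sub_zero]

lemma ae_differentiableAt (hf : IsSection f) :
    ∀ᵐ t, t ∈ Ioo (0 : ℝ) 1 → DifferentiableAt ℝ f t := by
  filter_upwards [(hf.absolutelyContinuous one_mem_Icc).ae_differentiableAt] with t ht h
  exact ht (by rw [uIcc_of_le zero_le_one]; exact Ioo_subset_Icc_self h)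

end IsSection

lemma deriv_nonneg_of_monotone_on_unit {f : ℝ → ℝ}
    (h : ∀ x ∈ Icc (0 : ℝ) 1, ∀ y ∈ Icc (0 : ℝ) 1, x ≤ y → f x ≤ f y) {t : ℝ}
    (ht : t ∈ Ioo (0 : ℝ) 1) : 0 ≤ deriv f t := by
  have hm : MonotoneOn f (Icc 0 1) := fun x hx y hy hxy => h x hx y hy hxy
  have h1 := hm.derivWithin_nonneg (x := t)
  rwa [derivWithin_of_mem_nhds (Icc_mem_nhds ht.1 ht.2)] at h1

lemma IsSection.deriv_mem {f : ℝ → ℝ} (hf : IsSection f) {t : ℝ}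
    (ht : t ∈ Ioo (0 : ℝ) 1) : deriv f t ∈ Icc (0 : ℝ) 1 := by
  refine ⟨deriv_nonneg_of_monotone_on_unit hf.mono ht, ?_⟩
  by_cases hd : DifferentiableAt ℝ f t
  · have := deriv_nonneg_of_monotone_on_unit (f := fun x => x - f x)
      (fun x hx y hy hxy => by linarith [hf.sub_le x hx y hy hxy]) ht
    rw [deriv_fun_sub differentiableAt_fun_id hd, deriv_id''] at this
    linarith
  -- Where the derivative fails to exist, `deriv` takes the default value 0, so the bounds need no
  -- exceptional set.
  · rw [deriv_zero_of_not_differentiableAt hd]; exact zero_le_one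

lemma IsSection.setIntegral_deriv {f : ℝ → ℝ} (hf : IsSection f) {x : ℝ}
    (hx : x ∈ Icc (0 : ℝ) 1) : ∫ t in Ioo 0 x, deriv f t = f x := by
  rw [← hf.integral_deriv hx, intervalIntegral.integral_of_le hx.1, integral_Ioc_eq_integral_Ioo]

/-! ### The Markov product of copulas -/

lemma markovProduct_eq (C D : ℝ → ℝ → ℝ) (u v : ℝ) : markovProduct C D u v =
    ∫ t in Ioo (0 : ℝ) 1, deriv (C u) t * deriv (fun s => D s v) t := by
  rw [markovProduct, intervalIntegral.integral_of_le zero_le_one, integral_Ioc_eq_integral_Ioo]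
  rfl

lemma integrable_of_bounds {g : ℝ → ℝ} (hg : Measurable g) {K : ℝ}
    (h : ∀ t ∈ Ioo (0 : ℝ) 1, |g t| ≤ K) : Integrable g (volume.restrict (Ioo 0 1)) :=
  Integrable.of_bound hg.aestronglyMeasurable K
    ((ae_restrict_mem measurableSet_Ioo).mono fun t ht => h t ht)

lemma integrable_deriv_mul {f g : ℝ → ℝ} (hf : IsSection f) (hg : IsSection g) :
    Integrable (fun t => deriv f t * deriv g t) (volume.restrict (Ioo 0 1)) := by
  refine integrable_of_bounds ((measurable_deriv f).mul (measurable_deriv g)) (K := 1)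
    fun t ht => ?_
  have h1 := hf.deriv_mem ht
  have h2 := hg.deriv_mem ht
  rw [abs_of_nonneg (mul_nonneg h1.1 h2.1)]
  exact mul_le_one₀ h1.2 h2.1 h2.2

/-- The Markov product of two copulas is a copula. -/
lemma IsCopula.markovProduct {C D : ℝ → ℝ → ℝ} (hC : IsCopula C) (hD : IsCopula D) :
    IsCopula (markovProduct C D) where
  left_zero v hv := by
    rw [markovProduct_eq]
    refine (setIntegral_congr_fun measurableSet_Ioo fun t ht => ?_).trans (integral_zero _ _)
    have : C 0 =ᶠ[𝓝 t] fun _ => 0 := by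
      filter_upwards [Icc_mem_nhds ht.1 ht.2] with s hs using hC.left_zero s hs
    simp [this.deriv_eq]
  right_zero u hu := by
    rw [markovProduct_eq]
    refine (setIntegral_congr_fun measurableSet_Ioo fun t ht => ?_).trans (integral_zero _ _)
    have : (fun s => D s 0) =ᶠ[𝓝 t] fun _ => 0 := by
      filter_upwards [Icc_mem_nhds ht.1 ht.2] with s hs using hD.right_zero s hs
    simp [this.deriv_eq]
  left_one v hv := by
    rw [markovProduct_eq]
    have h1 := (hD.isSection_left hv).setIntegral_deriv one_mem_Icc
    rw [hD.left_one v hv] at h1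
    refine (setIntegral_congr_fun measurableSet_Ioo fun t ht => ?_).trans h1
    have : C 1 =ᶠ[𝓝 t] fun s => s := by
      filter_upwards [Icc_mem_nhds ht.1 ht.2] with s hs using hC.left_one s hs
    simp [this.deriv_eq]
  right_one u hu := by
    rw [markovProduct_eq]
    have h1 := (hC.isSection_right hu).setIntegral_deriv one_mem_Icc
    rw [hC.right_one u hu] at h1
    refine (setIntegral_congr_fun measurableSet_Ioo fun t ht => ?_).trans h1
    have : (fun s => D s 1) =ᶠ[𝓝 t] fun s => s := by
      filter_upwards [Icc_mem_nhds ht.1 ht.2] with s hs using hD.right_one s hs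
    simp [this.deriv_eq]
  two_increasing u₁ hu₁ u₂ hu₂ v₁ hv₁ v₂ hv₂ hu hv := by
    have i {u v : ℝ} (hu : u ∈ Icc (0 : ℝ) 1) (hv : v ∈ Icc (0 : ℝ) 1) :
        Integrable (fun t => deriv (C u) t * deriv (fun s => D s v) t)
          (volume.restrict (Ioo 0 1)) :=
      integrable_deriv_mul (hC.isSection_right hu) (hD.isSection_left hv)
    have j {v : ℝ} (hv : v ∈ Icc (0 : ℝ) 1) :
        Integrable (fun t => deriv (C u₂) t * deriv (fun s => D s v) t -
          deriv (C u₁) t * deriv (fun s => D s v) t) (volume.restrict (Ioo 0 1)) :=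
      (i hu₂ hv).sub (i hu₁ hv)
    simp only [markovProduct_eq]
    suffices key : 0 ≤ ∫ t in Ioo (0 : ℝ) 1,
        ((deriv (C u₂) t * deriv (fun s => D s v₂) t - deriv (C u₁) t * deriv (fun s => D s v₂) t) -
          (deriv (C u₂) t * deriv (fun s => D s v₁) t -
            deriv (C u₁) t * deriv (fun s => D s v₁) t)) by
      rw [integral_sub (j hv₂) (j hv₁),
        integral_sub (i hu₂ hv₂) (i hu₁ hv₂), integral_sub (i hu₂ hv₁) (i hu₁ hv₁)] at key
      linarith
    refine setIntegral_nonneg_of_ae_restrict ?_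
    rw [EventuallyLE, ae_restrict_iff' measurableSet_Ioo]
    filter_upwards [(hC.isSection_right hu₁).ae_differentiableAt,
      (hC.isSection_right hu₂).ae_differentiableAt, (hD.isSection_left hv₁).ae_differentiableAt,
      (hD.isSection_left hv₂).ae_differentiableAt] with t h1 h2 h3 h4 ht
    -- The integrand factors as (increment of `∂₂C` in `u`) times (increment of `∂₁D` in `v`); both
    -- are nonnegative by 2-increasingness.
    have h5 : 0 ≤ deriv (fun s => C u₂ s - C u₁ s) t :=
      deriv_nonneg_of_monotone_on_unit (fun x hx y hy hxy => by
        linarith [hC.two_increasing u₁ hu₁ u₂ hu₂ x hx y hy hu hxy]) ht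
    have h6 : 0 ≤ deriv (fun s => D s v₂ - D s v₁) t :=
      deriv_nonneg_of_monotone_on_unit (fun x hx y hy hxy => by
        linarith [hD.two_increasing x hx y hy v₁ hv₁ v₂ hv₂ hxy hv]) ht
    rw [deriv_fun_sub (h2 ht) (h1 ht)] at h5
    rw [deriv_fun_sub (h4 ht) (h3 ht)] at h6
    have := mul_nonneg h5 h6
    simp only [Pi.zero_apply]
    linarith

/-! ### Markov products as averages -/

/-- Layer-cake representation: integrating `H'` against an essentially decreasing `g` with values
in `[0,1]` amounts to averaging `H` over the generalized inverse of `g`. -/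
lemma exists_integral_deriv_mul_eq {g : ℝ → ℝ} (hg : Measurable g)
    (hg01 : ∀ t ∈ Ioo (0 : ℝ) 1, g t ∈ Icc (0 : ℝ) 1) {N : Set ℝ} (hN : volume N = 0)
    (hanti : AntitoneOn g (Icc (0 : ℝ) 1 \ N)) :
    ∃ τ : ℝ → ℝ, Antitone τ ∧ (∀ y, τ y ∈ Icc (0 : ℝ) 1) ∧
      ∀ H : ℝ → ℝ, IsSection H →
        ∫ t in Ioo (0 : ℝ) 1, deriv H t * g t = ∫ y in Ioo (0 : ℝ) 1, H (τ y) := by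
  -- The inserted 0 keeps the supremum meaningful when the superlevel set is empty.
  set A : ℝ → Set ℝ := fun y => insert 0 {t | t ∈ Ioo (0 : ℝ) 1 ∧ t ∉ N ∧ y < g t} with hA
  have hbdd (y : ℝ) : BddAbove (A y) := ⟨1, by
    rintro t (rfl | ht)
    · exact zero_le_one
    · exact ht.1.2.le⟩
  have h01 (y : ℝ) : sSup (A y) ∈ Icc (0 : ℝ) 1 := by
    refine ⟨le_csSup (hbdd y) (mem_insert _ _), csSup_le ⟨0, mem_insert _ _⟩ ?_⟩
    rintro t (rfl | ht)
    · exact zero_le_one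
    · exact ht.1.2.le
  refine ⟨fun y => sSup (A y), fun y z hyz => ?_, h01, fun H hH => ?_⟩
  · exact csSup_le_csSup (hbdd y) ⟨0, mem_insert _ _⟩
      (insert_subset_insert fun t ht => ⟨ht.1, ht.2.1, hyz.trans_lt ht.2.2⟩)
  have hcake : ∀ t ∈ Ioo (0 : ℝ) 1, deriv H t * g t =
      ∫ y in Ioo (0 : ℝ) 1, (if y < g t then deriv H t else 0) := by
    intro t ht
    have h1 : (fun y => if y < g t then deriv H t else 0) =
        (Iio (g t)).indicator fun _ => deriv H t := by
      ext y; simp [indicator_apply]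
    have h2 : Ioo 0 1 ∩ Iio (g t) = Ioo 0 (g t) := by
      ext y
      simp only [mem_inter_iff, mem_Ioo, mem_Iio]
      constructor
      · exact fun h => ⟨h.1.1, h.2⟩
      · exact fun h => ⟨⟨h.1, h.2.trans_le (hg01 t ht).2⟩, h.2⟩
    rw [h1, setIntegral_indicator measurableSet_Iio, h2, setIntegral_const]
    simp [(hg01 t ht).1, mul_comm]
  rw [setIntegral_congr_fun measurableSet_Ioo hcake, integral_integral_swap]
  · refine setIntegral_congr_fun measurableSet_Ioo fun y hy => ?_
    have h1 : (fun t => if y < g t then deriv H t else 0) =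
        {t | y < g t}.indicator fun t => deriv H t := by
      ext t; simp [indicator_apply]
    have hm : MeasurableSet {t | y < g t} := measurableSet_lt measurable_const hg
    simp only
    rw [h1, setIntegral_indicator hm, ← hH.setIntegral_deriv (h01 y)]
    apply setIntegral_congr_set
    have hN' : ∀ᵐ t, t ∉ N := measure_eq_zero_iff_ae_notMem.mp hN
    have hne : ∀ᵐ t : ℝ, t ≠ sSup (A y) := by
      simp [ae_iff, measure_singleton]
    -- Off `N` and the endpoint, antitonicity identifies the superlevel set with `(0, sSup (A y))`.
    filter_upwards [hN', hne] with t htN hts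
    refine propext ⟨fun h => ?_, fun h => ?_⟩
    · have : t ≤ sSup (A y) := le_csSup (hbdd y) (Or.inr ⟨h.1, htN, h.2⟩)
      exact ⟨h.1.1, lt_of_le_of_ne this hts⟩
    · obtain ⟨s, hs, hts'⟩ := exists_lt_of_lt_csSup ⟨0, mem_insert _ _⟩ h.2
      have ht0 : 0 < t := h.1
      rcases hs with rfl | hs
      · exact absurd hts' ht0.not_gt
      · have ht1 : t < 1 := hts'.trans hs.1.2
        exact ⟨⟨ht0, ht1⟩, hs.2.2.trans_le
          (hanti ⟨⟨ht0.le, ht1.le⟩, htN⟩ ⟨Ioo_subset_Icc_self hs.1, hs.2.1⟩ hts'.le)⟩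
  · have hmeas : Measurable (Function.uncurry fun t y => if y < g t then deriv H t else 0) :=
      Measurable.ite (measurableSet_lt measurable_snd (hg.comp measurable_fst))
        ((measurable_deriv H).comp measurable_fst) measurable_const
    refine Integrable.of_bound hmeas.aestronglyMeasurable 1 ?_
    rw [Measure.prod_restrict, ae_restrict_iff' (measurableSet_Ioo.prod measurableSet_Ioo)]
    refine Eventually.of_forall fun p hp => ?_
    have := hH.deriv_mem hp.1
    simp only [Function.uncurry]
    split_ifs
    · rw [Real.norm_of_nonneg this.1]; exact this.2
    · simp

lemma isSection_min {u : ℝ} (hu : u ∈ Icc (0 : ℝ) 1) : IsSection (fun t => min u t) where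
  zero := min_eq_right hu.1
  mono x _ y _ h := min_le_min_left u h
  sub_le x _ y _ h := by
    rcases le_total u x with h1 | h1
    · rw [min_eq_left h1, min_eq_left (h1.trans h)]; linarith
    · rw [min_eq_right h1]; linarith [min_le_right u y]

/-- The derivative of `min u ·` is a.e. the indicator of `(0, u)`; hence `upperBound` is a left unit
of the Markov product. -/
lemma setIntegral_deriv_min_mul {u : ℝ} (hu : u ∈ Icc (0 : ℝ) 1) {f : ℝ → ℝ} (hf : IsSection f) :
    ∫ t in Ioo (0 : ℝ) 1, deriv (fun t => min u t) t * deriv f t = f u := by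
  have h2 : Ioo 0 1 ∩ Iio u = Ioo 0 u := by
    ext y
    simp only [mem_inter_iff, mem_Ioo, mem_Iio]
    constructor
    · exact fun h => ⟨h.1.1, h.2⟩
    · exact fun h => ⟨⟨h.1, h.2.trans_le hu.2⟩, h.2⟩
  rw [← hf.setIntegral_deriv hu, ← h2, ← setIntegral_indicator measurableSet_Iio]
  have hne : ∀ᵐ t : ℝ, t ≠ u := by simp [ae_iff, measure_singleton]
  refine integral_congr_ae (ae_restrict_of_ae ?_)
  filter_upwards [hne] with t ht
  rcases lt_or_gt_of_ne ht with h | h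
  · have : (fun t => min u t) =ᶠ[𝓝 t] fun s => s := by
      filter_upwards [Iio_mem_nhds h] with s hs using min_eq_right (le_of_lt hs)
    simp [this.deriv_eq, h]
  · have : (fun t => min u t) =ᶠ[𝓝 t] fun s => u := by
      filter_upwards [Ioi_mem_nhds h] with s hs using min_eq_left (le_of_lt hs)
    simp [this.deriv_eq, h.le]

/-- The Markov product with a stochastically increasing copula as an average, uniformly in the
first factor. -/
lemma StochasticallyIncreasing₁.exists_average {D : ℝ → ℝ → ℝ}
    (hSI : StochasticallyIncreasing₁ D) (hD : IsCopula D) {v : ℝ} (hv : v ∈ Icc (0 : ℝ) 1) :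
    ∃ τ : ℝ → ℝ, Antitone τ ∧ (∀ y, τ y ∈ Icc (0 : ℝ) 1) ∧
      (∀ u ∈ Icc (0 : ℝ) 1, D u v = ∫ y in Ioo (0 : ℝ) 1, min u (τ y)) ∧
      ∀ C, IsCopula C → ∀ u ∈ Icc (0 : ℝ) 1,
        markovProduct C D u v = ∫ y in Ioo (0 : ℝ) 1, C u (τ y) := by
  obtain ⟨N, hN, hanti⟩ := hSI v hv
  have hs := hD.isSection_left hv
  obtain ⟨τ, hτ, hτ01, h⟩ := exists_integral_deriv_mul_eq (measurable_deriv (fun s => D s v))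
    (fun t ht => hs.deriv_mem ht) hN hanti
  refine ⟨τ, hτ, hτ01, fun u hu => ?_, fun C hC u hu => ?_⟩
  · rw [← h _ (isSection_min hu), setIntegral_deriv_min_mul hu hs]
  · rw [markovProduct_eq]
    exact h _ (hC.isSection_right hu)

/-! ### Monotonicity of the powers; stochastic monotonicity as concavity -/

lemma IsCopula.le_min {C : ℝ → ℝ → ℝ} (hC : IsCopula C) {u v : ℝ} (hu : u ∈ Icc (0 : ℝ) 1)
    (hv : v ∈ Icc (0 : ℝ) 1) : C u v ≤ min u v :=
  _root_.le_min ((hC.isSection_left hv).le_self hu) ((hC.isSection_right hu).le_self hv)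

lemma IsSection.integrable_comp {f τ : ℝ → ℝ} (hf : IsSection f) (hτ : Antitone τ)
    (hτ01 : ∀ y, τ y ∈ Icc (0 : ℝ) 1) :
    Integrable (fun y => f (τ y)) (volume.restrict (Ioo 0 1)) := by
  have : Antitone (fun y => f (τ y)) := fun x y h => hf.mono _ (hτ01 y) _ (hτ01 x) (hτ h)
  refine integrable_of_bounds this.measurable (K := 1) fun t _ => ?_
  rw [abs_of_nonneg (hf.nonneg (hτ01 t))]
  exact (hf.le_self (hτ01 t)).trans (hτ01 t).2

lemma markovProduct_le_right {C D : ℝ → ℝ → ℝ} (hC : IsCopula C) (hD : IsCopula D)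
    (hSI : StochasticallyIncreasing₁ D) {u v : ℝ} (hu : u ∈ Icc (0 : ℝ) 1)
    (hv : v ∈ Icc (0 : ℝ) 1) : markovProduct C D u v ≤ D u v := by
  obtain ⟨τ, hτ, hτ01, h1, h2⟩ := hSI.exists_average hD hv
  rw [h1 u hu, h2 C hC u hu]
  exact integral_mono ((hC.isSection_right hu).integrable_comp hτ hτ01)
    ((isSection_min hu).integrable_comp hτ hτ01) fun y => hC.le_min hu (hτ01 y)

lemma concaveOn_average {K : ℝ → ℝ → ℝ} {τ : ℝ → ℝ}
    (hK : ∀ u ∈ Icc (0 : ℝ) 1, IsSection (K u)) (hτ : Antitone τ)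
    (hτ01 : ∀ y, τ y ∈ Icc (0 : ℝ) 1)
    (hc : ∀ s ∈ Icc (0 : ℝ) 1, ConcaveOn ℝ (Icc 0 1) fun u => K u s) :
    ConcaveOn ℝ (Icc (0 : ℝ) 1) fun u => ∫ y in Ioo (0 : ℝ) 1, K u (τ y) := by
  refine ⟨convex_Icc 0 1, fun x hx y hy a b ha hb hab => ?_⟩
  have i {u : ℝ} (hu : u ∈ Icc (0 : ℝ) 1) := (hK u hu).integrable_comp hτ hτ01
  simp only [smul_eq_mul]
  rw [← integral_const_mul, ← integral_const_mul,
    ← integral_add ((i hx).const_mul a) ((i hy).const_mul b)]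
  exact integral_mono (((i hx).const_mul a).add ((i hy).const_mul b))
    (i (convex_Icc 0 1 hx hy ha hb hab)) fun z => (hc _ (hτ01 z)).2 hx hy ha hb hab

lemma StochasticallyIncreasing₁.concaveOn {D : ℝ → ℝ → ℝ}
    (hSI : StochasticallyIncreasing₁ D) (hD : IsCopula D) {v : ℝ} (hv : v ∈ Icc (0 : ℝ) 1) :
    ConcaveOn ℝ (Icc (0 : ℝ) 1) fun u => D u v := by
  obtain ⟨τ, hτ, hτ01, h1, -⟩ := hSI.exists_average hD hv
  refine (concaveOn_average (fun u hu => isSection_min hu) hτ hτ01 fun s hs =>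
    (concaveOn_id (convex_Icc 0 1)).inf (concaveOn_const s (convex_Icc 0 1))).congr
      fun u hu => (h1 u hu).symm

lemma stochasticallyIncreasing₁_of_concaveOn {D : ℝ → ℝ → ℝ} (hD : IsCopula D)
    (hc : ∀ v ∈ Icc (0 : ℝ) 1, ConcaveOn ℝ (Icc (0 : ℝ) 1) fun u => D u v) :
    StochasticallyIncreasing₁ D := by
  intro v hv
  have hd := (hD.isSection_left hv).ae_differentiableAt
  -- The endpoints are discarded because `deriv` there sees the arbitrary values of `D` outside the
  -- square.
  refine ⟨{t | t ∈ Ioo (0 : ℝ) 1 → DifferentiableAt ℝ (fun s => D s v) t}ᶜ ∪ {0, 1},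
    measure_union_null hd ((Set.toFinite _).measure_zero _), ?_⟩
  rintro x ⟨hx, hxN⟩ y ⟨hy, hyN⟩ hxy
  simp only [mem_union, mem_compl_iff, mem_ofPred_eq, mem_insert_iff, mem_singleton_iff, not_or,
    not_not] at hxN hyN
  have hx' := hxN.1 ⟨lt_of_le_of_ne hx.1 (Ne.symm hxN.2.1), lt_of_le_of_ne hx.2 hxN.2.2⟩
  have hy' := hyN.1 ⟨lt_of_le_of_ne hy.1 (Ne.symm hyN.2.1), lt_of_le_of_ne hy.2 hyN.2.2⟩
  rcases hxy.eq_or_lt with rfl | hlt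
  · exact le_rfl
  · exact ((hc v hv).deriv_le_slope hx hy hlt hy').trans ((hc v hv).slope_le_deriv hx hy hlt hx')

lemma StochasticallyIncreasing₁.markovProduct {C D : ℝ → ℝ → ℝ} (hC : IsCopula C)
    (hD : IsCopula D) (hSC : StochasticallyIncreasing₁ C) (hSD : StochasticallyIncreasing₁ D) :
    StochasticallyIncreasing₁ (markovProduct C D) := by
  refine stochasticallyIncreasing₁_of_concaveOn (hC.markovProduct hD) fun v hv => ?_
  obtain ⟨τ, hτ, hτ01, -, h2⟩ := hSD.exists_average hD hv
  exact (concaveOn_average (fun u hu => hC.isSection_right hu) hτ hτ01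
    fun s hs => hSC.concaveOn hC hs).congr fun u hu => (h2 C hC u hu).symm

lemma markovPower_succ_isCopula_and_stochasticallyIncreasing₁ {C : ℝ → ℝ → ℝ} (hC : IsCopula C)
    (hSI : StochasticallyIncreasing₁ C) (n : ℕ) : IsCopula (markovPower C (n + 1)) ∧
      StochasticallyIncreasing₁ (markovPower C (n + 1)) := by
  induction n with
  | zero => exact ⟨hC, hSI⟩
  | succ n ih => exact ⟨hC.markovProduct ih.1, hSI.markovProduct hC ih.1 ih.2⟩

/-! ### Passage to the limit -/

/-- Concavity traps each derivative between a right and a left difference quotient. These converge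
in `n` for a fixed second point, and those of `F` are close to `deriv F t` once that point is near
`t`. -/
lemma tendsto_deriv_of_concaveOn {f : ℕ → ℝ → ℝ} {F : ℝ → ℝ}
    (hc : ∀ n, ConcaveOn ℝ (Icc (0 : ℝ) 1) (f n))
    (hlim : ∀ x ∈ Icc (0 : ℝ) 1, Tendsto (fun n => f n x) atTop (𝓝 (F x))) {t : ℝ}
    (ht : t ∈ Ioo (0 : ℝ) 1) (hd : ∀ n, DifferentiableAt ℝ (f n) t)
    (hF : DifferentiableAt ℝ F t) :
    Tendsto (fun n => deriv (f n) t) atTop (𝓝 (deriv F t)) := by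
  have htI := Ioo_subset_Icc_self ht
  have hslope := hasDerivAt_iff_tendsto_slope.mp hF.hasDerivAt
  have hlimslope {y : ℝ} (hy : y ∈ Icc (0 : ℝ) 1) :
      Tendsto (fun n => slope (f n) t y) atTop (𝓝 (slope F t y)) := by
    simp only [slope_def_field]
    exact ((hlim y hy).sub (hlim t htI)).div_const _
  refine tendsto_order.mpr ⟨fun a ha => ?_, fun a ha => ?_⟩
  · have h1 : ∀ᶠ y in 𝓝[>] t, a < slope F t y :=
      (hslope.mono_left (nhdsWithin_mono _ fun y hy => ne_of_gt hy)).eventually (lt_mem_nhds ha)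
    have h2 : ∀ᶠ y in 𝓝[>] t, y ∈ Ioo t 1 := Ioo_mem_nhdsGT ht.2
    obtain ⟨y, hy, hyt⟩ := (h1.and h2).exists
    have hyI : y ∈ Icc (0 : ℝ) 1 := ⟨ht.1.le.trans hyt.1.le, hyt.2.le⟩
    filter_upwards [(hlimslope hyI).eventually (lt_mem_nhds hy)] with n hn
    exact hn.trans_le ((hc n).slope_le_deriv htI hyI hyt.1 (hd n))
  · have h1 : ∀ᶠ y in 𝓝[<] t, slope F t y < a :=
      (hslope.mono_left (nhdsWithin_mono _ fun y hy => ne_of_lt hy)).eventually (gt_mem_nhds ha)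
    have h2 : ∀ᶠ y in 𝓝[<] t, y ∈ Ioo 0 t := Ioo_mem_nhdsLT ht.1
    obtain ⟨y, hy, hyt⟩ := (h1.and h2).exists
    have hyI : y ∈ Icc (0 : ℝ) 1 := ⟨hyt.1.le, hyt.2.le.trans ht.2.le⟩
    filter_upwards [(hlimslope hyI).eventually (gt_mem_nhds hy)] with n hn
    rw [slope_comm] at hn
    exact ((hc n).deriv_le_slope hyI htI hyt.2 (hd n)).trans_lt hn

section Limit

variable {D : ℕ → ℝ → ℝ → ℝ} {S : ℝ → ℝ → ℝ}

lemma isCopula_of_tendsto (hD : ∀ n, IsCopula (D n))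
    (hlim : ∀ u ∈ Icc (0 : ℝ) 1, ∀ v ∈ Icc (0 : ℝ) 1,
      Tendsto (fun n => D n u v) atTop (𝓝 (S u v))) : IsCopula S where
  left_zero v hv := tendsto_nhds_unique (hlim 0 zero_mem_Icc v hv)
    (by simp [(hD _).left_zero v hv])
  right_zero u hu := tendsto_nhds_unique (hlim u hu 0 zero_mem_Icc)
    (by simp [(hD _).right_zero u hu])
  left_one v hv := tendsto_nhds_unique (hlim 1 one_mem_Icc v hv)
    (by simp [(hD _).left_one v hv])
  right_one u hu := tendsto_nhds_unique (hlim u hu 1 one_mem_Icc)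
    (by simp [(hD _).right_one u hu])
  two_increasing u₁ hu₁ u₂ hu₂ v₁ hv₁ v₂ hv₂ hu hv :=
    ge_of_tendsto' ((((hlim u₂ hu₂ v₂ hv₂).sub (hlim u₁ hu₁ v₂ hv₂)).sub
      (hlim u₂ hu₂ v₁ hv₁)).add (hlim u₁ hu₁ v₁ hv₁))
      fun n => (hD n).two_increasing u₁ hu₁ u₂ hu₂ v₁ hv₁ v₂ hv₂ hu hv

lemma concaveOn_of_tendsto {f : ℕ → ℝ → ℝ} {F : ℝ → ℝ}
    (hc : ∀ n, ConcaveOn ℝ (Icc (0 : ℝ) 1) (f n))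
    (hlim : ∀ x ∈ Icc (0 : ℝ) 1, Tendsto (fun n => f n x) atTop (𝓝 (F x))) :
    ConcaveOn ℝ (Icc (0 : ℝ) 1) F :=
  ⟨convex_Icc 0 1, fun x hx y hy a b ha hb hab =>
    le_of_tendsto_of_tendsto' (((hlim x hx).const_mul a).add ((hlim y hy).const_mul b))
      (hlim _ (convex_Icc 0 1 hx hy ha hb hab)) fun n => (hc n).2 hx hy ha hb hab⟩

lemma stochasticallyIncreasing₁_of_tendsto (hD : ∀ n, IsCopula (D n))
    (hSI : ∀ n, StochasticallyIncreasing₁ (D n))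
    (hlim : ∀ u ∈ Icc (0 : ℝ) 1, ∀ v ∈ Icc (0 : ℝ) 1,
      Tendsto (fun n => D n u v) atTop (𝓝 (S u v))) : StochasticallyIncreasing₁ S :=
  stochasticallyIncreasing₁_of_concaveOn (isCopula_of_tendsto hD hlim) fun v hv =>
    concaveOn_of_tendsto (fun n => (hSI n).concaveOn (hD n) hv) fun u hu => hlim u hu v hv

/-- For stochastically increasing copulas the Markov product is continuous in its second factor
with respect to pointwise convergence. -/
lemma tendsto_markovProduct {C : ℝ → ℝ → ℝ} (hC : IsCopula C) (hD : ∀ n, IsCopula (D n))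
    (hSI : ∀ n, StochasticallyIncreasing₁ (D n))
    (hlim : ∀ u ∈ Icc (0 : ℝ) 1, ∀ v ∈ Icc (0 : ℝ) 1,
      Tendsto (fun n => D n u v) atTop (𝓝 (S u v))) {u v : ℝ}
    (hu : u ∈ Icc (0 : ℝ) 1) (hv : v ∈ Icc (0 : ℝ) 1) :
    Tendsto (fun n => markovProduct C (D n) u v) atTop (𝓝 (markovProduct C S u v)) := by
  have hS := isCopula_of_tendsto hD hlim
  simp only [markovProduct_eq]
  refine tendsto_integral_of_dominated_convergence (fun _ => 1)
    (fun n => ((measurable_deriv _).mul (measurable_deriv _)).aestronglyMeasurable)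
    (integrable_const 1) (fun n => ?_) ?_
  · filter_upwards [ae_restrict_mem measurableSet_Ioo] with t ht
    have h1 := (hC.isSection_right hu).deriv_mem ht
    have h2 := ((hD n).isSection_left hv).deriv_mem ht
    rw [Real.norm_of_nonneg (mul_nonneg h1.1 h2.1)]
    exact mul_le_one₀ h1.2 h2.1 h2.2
  · rw [ae_restrict_iff' measurableSet_Ioo]
    filter_upwards [ae_all_iff.mpr fun n => ((hD n).isSection_left hv).ae_differentiableAt,
      (hS.isSection_left hv).ae_differentiableAt] with t h1 h2 ht
    exact (tendsto_deriv_of_concaveOn (fun n => (hSI n).concaveOn (hD n) hv)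
      (fun x hx => hlim x hx v hv) ht (fun n => h1 n ht) (h2 ht)).const_mul _

end Limit

/-! ### Diagonal fixed points and the equation `C * S = S` -/

/-- The points at which the diagonal section of `C` agrees with that of the upper bound. -/
def diagonalFixedPoints (C : ℝ → ℝ → ℝ) : Set ℝ := {s | s ∈ Icc (0 : ℝ) 1 ∧ C s s = s}

/-- From the value `s` at `s`, the 1-Lipschitz bound gives the lower estimate to the left and
monotonicity the one to the right. -/
lemma IsCopula.eq_min_of_right {C : ℝ → ℝ → ℝ} (hC : IsCopula C) {u s : ℝ}
    (hu : u ∈ Icc (0 : ℝ) 1) (hs : s ∈ diagonalFixedPoints C) : C u s = min u s := by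
  refine le_antisymm (hC.le_min hu hs.1) ?_
  rcases le_total u s with h | h
  · have := (hC.isSection_left hs.1).sub_le u hu s hs.1 h
    simp only [hs.2] at this
    rw [min_eq_left h]; linarith
  · have := (hC.isSection_left hs.1).mono s hs.1 u hu h
    simp only [hs.2] at this
    rwa [min_eq_right h]

lemma IsCopula.eq_min_of_left {C : ℝ → ℝ → ℝ} (hC : IsCopula C) {s v : ℝ}
    (hv : v ∈ Icc (0 : ℝ) 1) (hs : s ∈ diagonalFixedPoints C) : C s v = min s v := by
  rw [min_comm]
  exact hC.flip.eq_min_of_right hv hs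

lemma IsCopula.isClosed_diagonalFixedPoints {C : ℝ → ℝ → ℝ} (hC : IsCopula C) :
    IsClosed (diagonalFixedPoints C) := by
  have hl : LipschitzOnWith 2 (fun s => C s s) (Icc 0 1) := by
    refine LipschitzOnWith.of_le_add_mul 2 fun x hx y hy => ?_
    simp only [Real.dist_eq, NNReal.coe_ofNat]
    rcases le_total x y with h | h
    · have h1 := (hC.isSection_left hx).mono x hx y hy h
      have h2 := (hC.isSection_right hy).mono x hx y hy h
      have := abs_nonneg (x - y)
      linarith
    · have h1 := (hC.isSection_left hx).sub_le y hy x hx h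
      have h2 := (hC.isSection_right hy).sub_le y hy x hx h
      have := le_abs_self (x - y)
      linarith
  have := (hl.continuousOn.sub continuousOn_id).preimage_isClosed_of_isClosed isClosed_Icc
    (isClosed_singleton (x := (0 : ℝ)))
  convert this using 1
  ext s
  simp [diagonalFixedPoints, sub_eq_zero]

lemma IsCopula.zero_mem_diagonalFixedPoints {C : ℝ → ℝ → ℝ} (hC : IsCopula C) :
    0 ∈ diagonalFixedPoints C := ⟨zero_mem_Icc, hC.left_zero 0 zero_mem_Icc⟩

lemma IsCopula.one_mem_diagonalFixedPoints {C : ℝ → ℝ → ℝ} (hC : IsCopula C) :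
    1 ∈ diagonalFixedPoints C := ⟨one_mem_Icc, hC.left_one 1 one_mem_Icc⟩

/-- The section `C s ·` equals `min s ·`, which acts as a unit. -/
lemma IsCopula.mem_diagonalFixedPoints_markovProduct {C D : ℝ → ℝ → ℝ} (hC : IsCopula C)
    (hD : IsCopula D) {s : ℝ} (hsC : s ∈ diagonalFixedPoints C)
    (hsD : s ∈ diagonalFixedPoints D) : s ∈ diagonalFixedPoints (Copulas.markovProduct C D) := by
  refine ⟨hsC.1, ?_⟩
  rw [markovProduct_eq]
  refine Eq.trans ?_ ((setIntegral_deriv_min_mul hsC.1 (hD.isSection_left hsC.1)).trans hsD.2)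
  refine setIntegral_congr_fun measurableSet_Ioo fun t ht => ?_
  have : C s =ᶠ[𝓝 t] fun t => min s t := by
    filter_upwards [Icc_mem_nhds ht.1 ht.2] with x hx using hC.eq_min_of_left hx hsC
  simp only [this.deriv_eq]

lemma mem_diagonalFixedPoints_markovPower {C : ℝ → ℝ → ℝ} (hC : IsCopula C)
    (hSI : StochasticallyIncreasing₁ C) {s : ℝ} (hs : s ∈ diagonalFixedPoints C) (n : ℕ) :
    s ∈ diagonalFixedPoints (markovPower C (n + 1)) := by
  induction n with
  | zero => exact hs
  | succ n ih =>
    exact hC.mem_diagonalFixedPoints_markovProduct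
      (markovPower_succ_isCopula_and_stochasticallyIncreasing₁ hC hSI n).1 hs ih

/-- If `C * S = S`, then the sections `S(·, v)` are affine between consecutive fixed points of the
diagonal of `C`. -/
lemma eq_convexCombination_of_markovProduct_eq {C S : ℝ → ℝ → ℝ} (hC : IsCopula C)
    (hS : IsCopula S) (hSI : StochasticallyIncreasing₁ S) {v : ℝ} (hv : v ∈ Icc (0 : ℝ) 1)
    (hfix : ∀ u ∈ Icc (0 : ℝ) 1, markovProduct C S u v = S u v) {a b : ℝ}
    (ha : a ∈ Icc (0 : ℝ) 1) (hb : b ∈ Icc (0 : ℝ) 1) (hab : a < b)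
    (hgap : ∀ s ∈ Ioo a b, s ∉ diagonalFixedPoints C) {u : ℝ} (hu : u ∈ Icc a b) :
    S u v = (b - u) / (b - a) * S a v + (u - a) / (b - a) * S b v := by
  obtain ⟨τ, hτ, hτ01, h1, h2⟩ := hSI.exists_average hS hv
  have hint {w : ℝ} (hw : w ∈ Icc (0 : ℝ) 1) := (isSection_min hw).integrable_comp hτ hτ01
  have hae {w : ℝ} (hw : w ∈ Icc (0 : ℝ) 1) :
      ∀ᵐ y ∂volume.restrict (Ioo (0 : ℝ) 1), C w (τ y) = min w (τ y) := by
    have hi := (hC.isSection_right hw).integrable_comp hτ hτ01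
    have h3 : ∫ y in Ioo (0 : ℝ) 1, (min w (τ y) - C w (τ y)) = 0 := by
      rw [integral_sub (hint hw) hi, ← h1 w hw, ← h2 C hC w hw, hfix w hw, sub_self]
    rw [integral_eq_zero_iff_of_nonneg (fun y => sub_nonneg.mpr (hC.le_min hw (hτ01 y)))
      ((hint hw).sub hi)] at h3
    filter_upwards [h3] with y hy
    exact (sub_eq_zero.mp hy).symm
  have hmem : ∀ᵐ y ∂volume.restrict (Ioo (0 : ℝ) 1), τ y ∈ diagonalFixedPoints C := by
    -- Rationals allow one null set for all `q`. If `C (τ y) (τ y) < q < τ y`, then `q = C q (τ y) ≤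
    -- C (τ y) (τ y)`, a contradiction.
    have hall : ∀ᵐ y ∂volume.restrict (Ioo (0 : ℝ) 1), ∀ q : ℚ, (q : ℝ) ∈ Icc (0 : ℝ) 1 →
        C q (τ y) = min (q : ℝ) (τ y) := by
      rw [ae_all_iff]
      intro q
      by_cases hq : (q : ℝ) ∈ Icc (0 : ℝ) 1
      · filter_upwards [hae hq] with y hy _ using hy
      · exact Eventually.of_forall fun y h => absurd h hq
    filter_upwards [hall] with y hy
    refine ⟨hτ01 y, le_antisymm ((hC.isSection_left (hτ01 y)).le_self (hτ01 y)) ?_⟩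
    by_contra! hlt
    obtain ⟨q, hq1, hq2⟩ := exists_rat_btwn hlt
    have hq : (q : ℝ) ∈ Icc (0 : ℝ) 1 :=
      ⟨((hC.isSection_left (hτ01 y)).nonneg (hτ01 y)).trans hq1.le, hq2.le.trans (hτ01 y).2⟩
    have h4 := (hC.isSection_left (hτ01 y)).mono _ hq _ (hτ01 y) hq2.le
    simp only [hy q hq, min_eq_left hq2.le] at h4
    linarith
  have huI : u ∈ Icc (0 : ℝ) 1 := ⟨ha.1.trans hu.1, hu.2.trans hb.2⟩
  have hba : b - a ≠ 0 := (sub_pos.mpr hab).ne'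
  rw [h1 u huI, h1 a ha, h1 b hb, ← integral_const_mul, ← integral_const_mul,
    ← integral_add ((hint ha).const_mul _) ((hint hb).const_mul _)]
  refine integral_congr_ae ?_
  filter_upwards [hmem] with y hy
  -- As `τ y` avoids the gap, `min · (τ y)` is constant or the identity on `[a, b]`, hence affine.
  rcases le_or_gt (τ y) a with h | h
  · rw [min_eq_right h, min_eq_right (h.trans hu.1), min_eq_right (h.trans hab.le)]
    field_simp; ring
  · have h' : b ≤ τ y := by
      by_contra! h'
      exact hgap _ ⟨h, h'⟩ hy
    rw [min_eq_left h.le, min_eq_left (hu.2.trans h'), min_eq_left h']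
    field_simp; ring

/-! ### Gaps of a closed set and the ordinal sum -/

lemma exists_gap {E : Set ℝ} (hE : IsClosed E) (h0 : 0 ∈ E) (h1 : 1 ∈ E) {v : ℝ}
    (hv : v ∈ Icc (0 : ℝ) 1) (hvE : v ∉ E) :
    ∃ a ∈ E, ∃ b ∈ E, v ∈ Ioo a b ∧ ∀ s ∈ Ioo a b, s ∉ E := by
  have c1 : IsCompact (E ∩ Icc 0 v) := isCompact_Icc.inter_left hE
  have c2 : IsCompact (E ∩ Icc v 1) := isCompact_Icc.inter_left hE
  obtain ⟨a, ⟨haE, ha⟩, ha'⟩ := c1.exists_isGreatest ⟨0, h0, le_rfl, hv.1⟩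
  obtain ⟨b, ⟨hbE, hb⟩, hb'⟩ := c2.exists_isLeast ⟨1, h1, hv.2, le_rfl⟩
  have hav : a ≠ v := by rintro rfl; exact hvE haE
  have hbv : v ≠ b := by rintro rfl; exact hvE hbE
  refine ⟨a, haE, b, hbE, ⟨lt_of_le_of_ne ha.2 hav, lt_of_le_of_ne hb.1 hbv⟩, fun s hs hsE => ?_⟩
  rcases le_total s v with h | h
  · exact absurd (ha' ⟨hsE, ha.1.trans hs.1.le, h⟩) hs.1.not_ge
  · exact absurd (hb' ⟨hsE, h, hs.2.le.trans hb.2⟩) hs.2.not_ge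

/-- The bounded components of the complement of `E`, given by their endpoints. -/
def Gap (E : Set ℝ) : Type :=
  {p : ℝ × ℝ // p.1 ∈ E ∧ p.2 ∈ E ∧ p.1 < p.2 ∧ ∀ s ∈ Ioo p.1 p.2, s ∉ E}

lemma Gap.isIntervalFamily {E : Set ℝ} (hE : E ⊆ Icc 0 1) :
    IsIntervalFamily (fun k : Gap E => k.1.1) (fun k : Gap E => k.1.2) := by
  have hdisj : ∀ k l : Gap E, k ≠ l → Disjoint (Ioo k.1.1 k.1.2) (Ioo l.1.1 l.1.2) := by
    intro k l hkl
    rw [Set.disjoint_left]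
    intro x hk hl
    refine hkl (Subtype.ext (Prod.ext (le_antisymm ?_ ?_) (le_antisymm ?_ ?_)))
    · by_contra! h
      exact l.2.2.2.2 _ ⟨h, hk.1.trans hl.2⟩ k.2.1
    · by_contra! h
      exact k.2.2.2.2 _ ⟨h, hl.1.trans hk.2⟩ l.2.1
    · by_contra! h
      exact k.2.2.2.2 _ ⟨hk.1.trans hl.2, h⟩ l.2.2.1
    · by_contra! h
      exact l.2.2.2.2 _ ⟨hl.1.trans hk.2, h⟩ k.2.2.1
  exact {
    countable := by
      have := Set.PairwiseDisjoint.countable_of_isOpen (s := fun k : Gap E => Ioo k.1.1 k.1.2)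
        (a := univ) (fun k _ l _ hkl => hdisj k l hkl) (fun _ _ => isOpen_Ioo)
        (fun k _ => nonempty_Ioo.mpr k.2.2.2.1)
      exact countable_univ_iff.mp this
    nonneg := fun k => (hE k.2.1).1
    lt := fun k => k.2.2.2.1
    le_one := fun k => (hE k.2.2.1).2
    disjoint := hdisj }

/-- Inside a block, interpolate between `S a v = a` and `S b v = v`. Elsewhere, monotonicity from
the gap endpoint separating `u` from `v` yields the lower bound `min u v`. -/
lemma isOrdinalSum_of_markovProduct_eq {C S : ℝ → ℝ → ℝ} (hC : IsCopula C)
    (hS : IsCopula S) (hSI : StochasticallyIncreasing₁ S)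
    (hfix : ∀ u ∈ Icc (0 : ℝ) 1, ∀ v ∈ Icc (0 : ℝ) 1, markovProduct C S u v = S u v)
    (hsub : diagonalFixedPoints C ⊆ diagonalFixedPoints S) :
    IsOrdinalSum (fun k : Gap (diagonalFixedPoints C) => k.1.1) (fun k => k.1.2)
      (fun _ => independence) S where
  isCopula := hS
  eq_of_mem := by
    rintro ⟨⟨a, b⟩, ha, hb, hab, hgap⟩ u hu v hv
    simp only at ha hb hab hgap hu hv ⊢
    have hvI : v ∈ Icc (0 : ℝ) 1 := ⟨ha.1.1.trans hv.1.le, hv.2.le.trans hb.1.2⟩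
    rw [eq_convexCombination_of_markovProduct_eq hC hS hSI hvI (fun w hw => hfix w hw v hvI)
      ha.1 hb.1 hab hgap (Ioo_subset_Icc_self hu), hS.eq_min_of_left hvI (hsub ha),
      hS.eq_min_of_left hvI (hsub hb), min_eq_left hv.1.le, min_eq_right hv.2.le, independence]
    have hba : b - a ≠ 0 := (sub_pos.mpr hab).ne'
    field_simp
    ring
  eq_of_notMem u hu v hv hk := by
    by_cases hvE : v ∈ diagonalFixedPoints C
    · exact hS.eq_min_of_right hu (hsub hvE)
    obtain ⟨a, ha, b, hb, hvab, hgap⟩ := exists_gap hC.isClosed_diagonalFixedPoints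
      hC.zero_mem_diagonalFixedPoints hC.one_mem_diagonalFixedPoints hv hvE
    refine le_antisymm (hS.le_min hu hv) ?_
    rw [upperBound]
    rcases le_or_gt u a with h | h
    · have h1 := (hS.isSection_right hu).mono a ha.1 v hv hvab.1.le
      simp only [hS.eq_min_of_right hu (hsub ha), min_eq_left h] at h1
      exact (min_le_left _ _).trans h1
    · have hbu : b ≤ u := by
        by_contra! h'
        exact hk ⟨(a, b), ha, hb, hvab.1.trans hvab.2, hgap⟩ ⟨⟨h, h'⟩, hvab⟩
      have h1 := (hS.isSection_left hv).mono b hb.1 u hu hbu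
      simp only [hS.eq_min_of_left hv (hsub hb), min_eq_right hvab.2.le] at h1
      exact (min_le_right _ _).trans h1

/-! ### Convergence of the powers -/

lemma markovPower_succ_le {C : ℝ → ℝ → ℝ} (hC : IsCopula C) (hSI : StochasticallyIncreasing₁ C)
    {u v : ℝ} (hu : u ∈ Icc (0 : ℝ) 1) (hv : v ∈ Icc (0 : ℝ) 1) (n : ℕ) :
    markovPower C (n + 2) u v ≤ markovPower C (n + 1) u v :=
  have h := markovPower_succ_isCopula_and_stochasticallyIncreasing₁ hC hSI n
  markovProduct_le_right hC h.1 h.2 hu hv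

lemma exists_tendsto_markovPower {C : ℝ → ℝ → ℝ} (hC : IsCopula C)
    (hSI : StochasticallyIncreasing₁ C) : ∃ S : ℝ → ℝ → ℝ,
      ∀ u ∈ Icc (0 : ℝ) 1, ∀ v ∈ Icc (0 : ℝ) 1,
        Tendsto (fun n : ℕ => markovPower C (n + 1) u v) atTop (𝓝 (S u v)) := by
  refine ⟨fun u v => ⨅ n : ℕ, markovPower C (n + 1) u v, fun u hu v hv =>
    tendsto_atTop_ciInf (antitone_nat_of_succ_le fun n => markovPower_succ_le hC hSI hu hv n)
      ⟨0, ?_⟩⟩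
  rintro _ ⟨n, rfl⟩
  exact ((markovPower_succ_isCopula_and_stochasticallyIncreasing₁ hC hSI n).1.isSection_left
    hv).nonneg hu

end Copulas

theorem mainTheorem8 (C : ℝ → ℝ → ℝ) (hC : Copulas.IsCopula C)
    (hSI : Copulas.StochasticallyIncreasing₁ C) :
    (∀ u ∈ Set.Icc (0 : ℝ) 1, ∀ v ∈ Set.Icc (0 : ℝ) 1, ∀ n : ℕ, 1 ≤ n →
      Copulas.markovPower C (n + 1) u v ≤ Copulas.markovPower C n u v) ∧
    ∃ (I : Type) (a b : I → ℝ) (S : ℝ → ℝ → ℝ),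
      Copulas.IsIntervalFamily a b ∧
      Copulas.IsOrdinalSum a b (fun _ => Copulas.independence) S ∧
      ∀ u ∈ Set.Icc (0 : ℝ) 1, ∀ v ∈ Set.Icc (0 : ℝ) 1,
        Filter.Tendsto (fun n : ℕ => Copulas.markovPower C n u v) Filter.atTop (nhds (S u v)) := by
  have hpow := Copulas.markovPower_succ_isCopula_and_stochasticallyIncreasing₁ hC hSI
  refine ⟨fun u hu v hv n hn => ?_, ?_⟩
  · obtain ⟨m, rfl⟩ := Nat.exists_eq_add_of_le' hn
    exact Copulas.markovPower_succ_le hC hSI hu hv m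
  obtain ⟨S, hlim⟩ := Copulas.exists_tendsto_markovPower hC hSI
  refine ⟨Copulas.Gap (Copulas.diagonalFixedPoints C), fun k => k.1.1, fun k => k.1.2, S,
    Copulas.Gap.isIntervalFamily fun s hs => hs.1,
    Copulas.isOrdinalSum_of_markovProduct_eq hC
      (Copulas.isCopula_of_tendsto (fun n => (hpow n).1) hlim)
      (Copulas.stochasticallyIncreasing₁_of_tendsto (fun n => (hpow n).1) (fun n => (hpow n).2)
        hlim)
      -- `C * C^{*(n+1)} = C^{*(n+2)}` tends both to `C * S` and, as a shifted sequence, to `S`.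
      (fun u hu v hv => tendsto_nhds_unique
        (Copulas.tendsto_markovProduct hC (fun n => (hpow n).1) (fun n => (hpow n).2) hlim hu hv)
        ((Filter.tendsto_add_atTop_iff_nat 1).mpr (hlim u hu v hv)))
      (fun s hs => ⟨hs.1, tendsto_nhds_unique (hlim s hs.1 s hs.1) ?_⟩),
    fun u hu v hv => (Filter.tendsto_add_atTop_iff_nat 1).mp (hlim u hu v hv)⟩
  simp only [fun n => (Copulas.mem_diagonalFixedPoints_markovPower hC hSI hs n).2]
  exact tendsto_const_nhds
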